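/- Let $q\ge 3$ be an integer, $\ell=2\cos(\pi/q)$, and consider in $\mathrm{PGL}_2(\mathbb R)$ the elements $$S=\begin{bmatrix}0&1\\-1&0\end{bmatrix},\quad T=\begin{bmatrix}1&\ell\\0&1\end{bmatrix},\quad Q=\begin{bmatrix}0&1\\1&0\end{bmatrix},\quad g_k=\big((TS)^kS\big)^{-1}\ (k\in\mathbb Z),$$ acting on $\mathbb R\cup\{\infty\}$ by fractional linear transformations. Let $\Gamma_q=\langle S,T\rangle$ be the Hecke triangle group and $\widetilde\Gamma_q=\langle\Gamma_q,Q\rangle$ its underlying triangle group. Let $\chi$ be a unitary representation of $\widetilde\Gamma_q$ on a finite-dimensional complex inner product space $V$, and for $s\in\mathbb C$ and $h\in\widetilde\Gamma_q$ put $$\alpha_s(h)f(x)=|(h^{-1})'(x)|^{s}\,\chi(h)\,f(h^{-1}.x).$$ Let $m=\lfloor (q-1)/2\rfloor$. The even ($+$) and odd ($-$) slow transfer operators are $$\mathcal L_s^{\pm}=\sum_{k=1}^m\big(\alpha_s(g_{-k})\pm\alpha_s(Qg_{-k})\big)\quad(q\text{ odd}),$$ $$\mathcal L_s^{\pm}=\tfrac12\big(\alpha_s(g_{q/2})\pm\alpha_s(Qg_{q/2})\big)+\sum_{k=1}^m\big(\alpha_s(g_{-k})\pm\alpha_s(Qg_{-k})\big)\quad(q\text{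 even}),$$ acting on $V$-valued functions on $I$, where $I=(0,1)$ if $q$ is odd and $I=(0,\infty)$ if $q$ is even. Let $\mathrm{SFE}_s^{\omega,\pm}$ be the space of real-analytic $\varphi\colon I\to V$ with $\mathcal L_s^{\pm}\varphi=\varphi$ on $I$, and let $$\mathrm{SFE}_s^{\omega,\mathrm{as},\pm}=\Big\{\varphi\in\mathrm{SFE}_s^{\omega,\pm}\ \Big|\ \exists\,c\in V\colon\ \varphi(x)=\frac cx+O(1)\text{ as }x\to0^+\Big\}.$$ Let $E_1=\{v\in V\mid\chi(g_{-1})v=v\}$, let $E_r$ be the orthogonal complement of $E_1$ in $V$, and let $\mathrm{pr}_r\colon V\to E_r$ be the orthogonal projection. Then for every $s\in\mathbb C$ with $\operatorname{Re}s>0$ and $s\ne\frac12$, and for either choice of sign, $$\mathrm{SFE}_s^{\omega,\mathrm{as},\pm}=\Big\{\varphi\in\mathrm{SFE}_s^{\omega,\pm}\ \Big|\ \exists\,c\in V,\ \mathrm{pr}_r(c)=0\colon\ \varphi(x)=\frac cx+O(1)\text{ as }x\to0^+\Big\}.$$ In other words, for every element of $\mathrm{SFE}_s^{\omega,\mathrm{as},\pm}$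 the coefficient $c$ can be taken in $E_1$, the space of vectors fixed by $\chi(g_{-1})$. -/

import Mathlib

open Matrix Filter Topology Asymptotics
open scoped MatrixGroups

noncomputable section

namespace HeckeSFE

/-- The fractional linear action `g.x = (a x + b) / (c x + d)` of `PGL(2, ℝ)` on the real line
(with the usual junk value `0` at a pole of `g`). -/
def mobius (g : PGL(2, ℝ)) (x : ℝ) : ℝ :=
  Quotient.liftOn g (fun A : GL (Fin 2) ℝ => (A 0 0 * x + A 0 1) / (A 1 0 * x + A 1 1)) (by
    intro A B h
    obtain ⟨u, rfl⟩ := ProjGenLinGroup.mk_eq_mk_iff.1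
      (Quotient.sound h : ProjGenLinGroup.mk A = ProjGenLinGroup.mk B)
    have hu : (u : ℝ) ≠ 0 := u.ne_zero
    have e : ∀ i j, (A * GeneralLinearGroup.scalar (Fin 2) u) i j = A i j * u := by
      intro i j
      simp [Matrix.mul_apply, Matrix.diagonal]
    simp only [e]
    rw [show A 0 0 * u * x + A 0 1 * u = (A 0 0 * x + A 0 1) * u by ring,
      show A 1 0 * u * x + A 1 1 * u = (A 1 0 * x + A 1 1) * u by ring,
      mul_div_mul_right _ _ hu])

/-- The absolute value of the derivative of `x ↦ g.x`, that is
`|g'(x)| = |a d - b c| * (c x + d) ^ (-2)`. -/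
def absDeriv (g : PGL(2, ℝ)) (x : ℝ) : ℝ :=
  Quotient.liftOn g
    (fun A : GL (Fin 2) ℝ =>
      |A 0 0 * A 1 1 - A 0 1 * A 1 0| / (A 1 0 * x + A 1 1) ^ 2) (by
    intro A B h
    obtain ⟨u, rfl⟩ := ProjGenLinGroup.mk_eq_mk_iff.1
      (Quotient.sound h : ProjGenLinGroup.mk A = ProjGenLinGroup.mk B)
    have hu : (u : ℝ) ^ 2 ≠ 0 := pow_ne_zero _ u.ne_zero
    have e : ∀ i j, (A * GeneralLinearGroup.scalar (Fin 2) u) i j = A i j * u := by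
      intro i j
      simp [Matrix.mul_apply, Matrix.diagonal]
    simp only [e]
    rw [show A 0 0 * u * (A 1 1 * u) - A 0 1 * u * (A 1 0 * u)
          = (A 0 0 * A 1 1 - A 0 1 * A 1 0) * (u : ℝ) ^ 2 by ring,
      show (A 1 0 * u * x + A 1 1 * u) ^ 2 = (A 1 0 * x + A 1 1) ^ 2 * (u : ℝ) ^ 2 by ring,
      abs_mul, abs_of_nonneg (sq_nonneg (u : ℝ)), mul_div_mul_right _ _ hu])

/-- `ℓ(q) = 2 cos (π / q)`. -/
def ell (q : ℕ) : ℝ := 2 * Real.cos (Real.pi / q)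

/-- `S = [0, 1; -1, 0]` -/
def matS : PGL(2, ℝ) :=
  ProjGenLinGroup.mk (GeneralLinearGroup.mkOfDetNeZero !![0, 1; -1, 0] (by simp))

/-- `T_q = [1, ℓ(q); 0, 1]` -/
def matT (q : ℕ) : PGL(2, ℝ) :=
  ProjGenLinGroup.mk (GeneralLinearGroup.mkOfDetNeZero !![1, ell q; 0, 1] (by simp))

/-- `Q = [0, 1; 1, 0]` -/
def matQ : PGL(2, ℝ) :=
  ProjGenLinGroup.mk (GeneralLinearGroup.mkOfDetNeZero !![0, 1; 1, 0] (by simp))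

/-- The Hecke triangle group `Γ_q = ⟨S, T_q⟩`, inside `PSL(2, ℝ) ⊆ PGL(2, ℝ)`. -/
def heckeGroup (q : ℕ) : Subgroup PGL(2, ℝ) := Subgroup.closure {matS, matT q}

/-- The underlying triangle group `⟨Γ_q, Q⟩`. -/
def triangleGroup (q : ℕ) : Subgroup PGL(2, ℝ) :=
  heckeGroup q ⊔ Subgroup.zpowers matQ

/-- `S` as an element of the triangle group. -/
def elS (q : ℕ) : triangleGroup q :=
  ⟨matS, Subgroup.mem_sup_left (Subgroup.subset_closure (by simp))⟩

/-- `T_q` as an element of the triangle group. -/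
def elT (q : ℕ) : triangleGroup q :=
  ⟨matT q, Subgroup.mem_sup_left (Subgroup.subset_closure (by simp))⟩

/-- `Q` as an element of the triangle group. -/
def elQ (q : ℕ) : triangleGroup q :=
  ⟨matQ, Subgroup.mem_sup_right (Subgroup.mem_zpowers matQ)⟩

/-- `g_{q,k} = ((T_q S)^k S)⁻¹` -/
def elg (q : ℕ) (k : ℤ) : triangleGroup q := ((elT q * elS q) ^ k * elS q)⁻¹

section Operators

variable {V : Type*} [NormedAddCommGroup V] [InnerProductSpace ℂ V] {q : ℕ}

/-- The action `α_s(h) f (x) = |(h⁻¹)'(x)|^s χ(h) f(h⁻¹.x)`, where `χ` is a unitary representation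
of the triangle group on `V`. -/
def alpha (χ : triangleGroup q →* (V ≃ₗᵢ[ℂ] V)) (s : ℂ) (h : triangleGroup q)
    (f : ℝ → V) (x : ℝ) : V :=
  ((absDeriv (h⁻¹ : triangleGroup q) x : ℝ) : ℂ) ^ s • χ h (f (mobius (h⁻¹ : triangleGroup q) x))

/-- The interval on which the slow eigenfunctions live: `(0, 1)` for odd `q`, and `(0, ∞)` for
even `q`. -/
def slowDomain (q : ℕ) : Set ℝ := if Odd q then Set.Ioo 0 1 else Set.Ioi 0

/-- The even (`ε = 1`) or odd (`ε = -1`) slow transfer operator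
`∑_{k=1}^m (α_s(g_{-k}) ± α_s(Q g_{-k}))` with `m = ⌊(q-1)/2⌋`, to which
`1/2 α_s(g_{q/2}) ± 1/2 α_s(Q g_{q/2})` is added if `q` is even. -/
def slowOp (χ : triangleGroup q →* (V ≃ₗᵢ[ℂ] V)) (s : ℂ) (ε : ℤˣ) (f : ℝ → V) (x : ℝ) : V :=
  (∑ k ∈ Finset.Icc 1 ((q - 1) / 2),
    (alpha χ s (elg q (-(k : ℤ))) f x + ε • alpha χ s (elQ q * elg q (-(k : ℤ))) f x)) +
  if Even q then
    (1 / 2 : ℂ) • (alpha χ s (elg q ((q / 2 : ℕ) : ℤ)) f x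
      + ε • alpha χ s (elQ q * elg q ((q / 2 : ℕ) : ℤ)) f x)
  else 0

/-- The space `SFE_{q,s}^{ω,±}` of real-analytic eigenfunctions with eigenvalue `1` of the slow
transfer operator. Only the values on `slowDomain q` are constrained. -/
def SFE (χ : triangleGroup q →* (V ≃ₗᵢ[ℂ] V)) (s : ℂ) (ε : ℤˣ) : Set (ℝ → V) :=
  {φ | AnalyticOnNhd ℝ φ (slowDomain q) ∧ ∀ x ∈ slowDomain q, φ x = slowOp χ s ε φ x}

/-- `φ(x) = c / x + O(1)` as `x → 0⁺` -/
def HasPoleAsymptotics (φ : ℝ → V) (c : V) : Prop :=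
  (fun x : ℝ => φ x - ((1 / x : ℝ) : ℂ) • c) =O[𝓝[>] (0 : ℝ)] (fun _ => (1 : ℝ))

/-- The subspace `SFE_{q,s}^{ω,as,±}` of those `φ` with `φ(x) = c / x + O(1)` as `x → 0⁺` for
some `c ∈ V`. -/
def SFEas (χ : triangleGroup q →* (V ≃ₗᵢ[ℂ] V)) (s : ℂ) (ε : ℤˣ) : Set (ℝ → V) :=
  {φ | φ ∈ SFE χ s ε ∧ ∃ c : V, HasPoleAsymptotics φ c}

/-- `E_1 = {v ∈ V | χ(g_{-1}) v = v}` -/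
def fixedSpace (χ : triangleGroup q →* (V ≃ₗᵢ[ℂ] V)) : Submodule ℂ V where
  carrier := {v | χ (elg q (-1)) v = v}
  add_mem' := by
    intro a b ha hb
    simp only [Set.mem_ofPred_eq] at *
    rw [map_add, ha, hb]
  zero_mem' := by simp
  smul_mem' := by
    intro c v hv
    simp only [Set.mem_ofPred_eq] at *
    rw [map_smul, hv]

/-- The orthogonal projection `pr_r` of `V` on the orthogonal complement `E_r` of `E_1`. -/
def prr [FiniteDimensional ℂ V] (χ : triangleGroup q →* (V ≃ₗᵢ[ℂ] V)) :
    V →L[ℂ] (fixedSpace χ)ᗮ :=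
  (fixedSpace χ)ᗮ.orthogonalProjectionOnto

end Operators

end HeckeSFE

end

/-!
Let `φ` be an eigenfunction with `φ(x) = c / x + O(1)` as `x → 0⁺`. Multiply the equation
`φ = L φ` by `x` and let `x → 0⁺`. The left-hand side tends to `c`
(`HasPoleAsymptotics.tendsto_smul`). As `g_{-1}⁻¹.x = x / (1 + ℓ x)`, the term `α_s(g_{-1}) φ` has
again a simple pole, with coefficient `χ(g_{-1}) c` (`tendsto_smul_alpha_elg_neg_one`). All other
terms of `L φ` are bounded near `0` (`isBigO_sub_alpha_elg_neg_one`), so that they do not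
contribute to the limit. Hence `χ(g_{-1}) c = c`, which means that `c` lies in `E_1` and its
projection on the orthogonal complement of `E_1` vanishes.

For the boundedness the branches are made explicit. With `s_j = sin (j π / q)`, the inverses of
`g_{-k}` and of `Q g_{-k}` are given by the matrices `[s_k, s_{k-1}; s_{k+1}, s_k]` and
`[s_{k-1}, s_k; s_k, s_{k+1}]` (`coe_inv_elg`, `coe_inv_elQ_mul_elg`) for all `k ∈ ℤ`; the branches
of `g_{q/2}` are the case `k = -q/2`. Positivity of the sine on `(0, π)` and its monotonicity on
`[0, π / 2]` show that they map `0` to points of the domain of `φ`, where `φ` is continuous, except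
for `g_{-1}`, which fixes `0`, and, for odd `q`, for `Q g_{-(q-1)/2}`, which maps `0` to the end
point `1` of `(0, 1)`. There `φ` is bounded by the eigenvalue equation itself: all branches map `1`
into the interior of `(0, 1)` (`isBigO_nhdsLT_one_of_mem_SFE`).
-/

namespace HeckeSFE

/-! ### Sines of multiples of `π / q` -/

/-- The numbers `sin (k π / q)` for `k ∈ ℤ`. -/
noncomputable def sinMul (q : ℕ) (k : ℤ) : ℝ := Real.sin (k * (Real.pi / q))

lemma sinMul_add_one_add_sub_one (q : ℕ) (k : ℤ) :
    sinMul q (k + 1) + sinMul q (k - 1) = ell q * sinMul q k := by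
  simp only [sinMul, ell, Int.cast_add, Int.cast_sub, Int.cast_one, add_mul, sub_mul, one_mul,
    Real.sin_add, Real.sin_sub]
  ring

lemma sinMul_sq_sub (q : ℕ) (k : ℤ) :
    sinMul q k * sinMul q k - sinMul q (k - 1) * sinMul q (k + 1) = sinMul q 1 ^ 2 := by
  simp only [sinMul, Int.cast_add, Int.cast_sub, Int.cast_one, add_mul, sub_mul, one_mul,
    Real.sin_add, Real.sin_sub]
  linear_combination
    Real.sin (Real.pi / q) ^ 2 * Real.sin_sq_add_cos_sq (k * (Real.pi / q))
      - Real.sin (k * (Real.pi / q)) ^ 2 * Real.sin_sq_add_cos_sq (Real.pi / q)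

@[simp] lemma sinMul_zero (q : ℕ) : sinMul q 0 = 0 := by simp [sinMul]

lemma sinMul_sub {q : ℕ} (hq : 0 < q) (k : ℤ) : sinMul q (q - k) = sinMul q k := by
  have : (q : ℝ) ≠ 0 := by positivity
  simp only [sinMul]
  rw [← Real.sin_pi_sub]
  congr 1
  push_cast
  field_simp
  ring

lemma sinMul_pos {q : ℕ} {k : ℤ} (h0 : 0 < k) (hk : k < q) : 0 < sinMul q k := by
  have hq : (0 : ℝ) < q := by exact_mod_cast h0.trans hk
  have h0' : (0 : ℝ) < k := by exact_mod_cast h0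
  have hk' : (k : ℝ) < q := by exact_mod_cast hk
  apply Real.sin_pos_of_pos_of_lt_pi
  · positivity
  · rw [← mul_div_assoc, div_lt_iff₀ hq, mul_comm]
    exact mul_lt_mul_of_pos_left hk' Real.pi_pos

lemma sinMul_lt_sinMul {q : ℕ} {j k : ℤ} (hj : 0 ≤ j) (hjk : j < k) (hk : 2 * k ≤ q) :
    sinMul q j < sinMul q k := by
  have hq : (0 : ℝ) < q := by exact_mod_cast (by omega : (0 : ℤ) < q)
  have hj' : (0 : ℝ) ≤ j := by exact_mod_cast hj
  have hjk' : (j : ℝ) < k := by exact_mod_cast hjk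
  have hk' : 2 * (k : ℝ) ≤ q := by exact_mod_cast hk
  apply Real.sin_lt_sin_of_lt_of_le_pi_div_two
  · have : 0 ≤ (j : ℝ) * (Real.pi / q) := by positivity
    linarith [Real.pi_pos]
  · rw [← mul_div_assoc, div_le_div_iff₀ hq two_pos]
    nlinarith [Real.pi_pos]
  · exact mul_lt_mul_of_pos_right hjk' (by positivity)

lemma sinMul_le_sinMul_add_one {q : ℕ} {k : ℤ} (hk : 0 ≤ k) (hkq : 2 * k + 1 ≤ q) :
    sinMul q k ≤ sinMul q (k + 1) := by
  rcases hkq.lt_or_eq with h | h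
  · exact (sinMul_lt_sinMul hk (by omega) (by omega)).le
  · rw [← sinMul_sub (by omega) k, ← h]
    exact (congrArg (sinMul q) (by ring)).le

lemma sinMul_nonneg {q : ℕ} {k : ℤ} (h0 : 0 ≤ k) (hk : k < q) : 0 ≤ sinMul q k := by
  rcases h0.eq_or_lt with rfl | h
  · simp
  · exact (sinMul_pos h hk).le

/-! ### The branches of the slow transfer operator as matrices -/

/-- The matrix `[s_k, s_{k-1}; s_{k+1}, s_k]` with `s_j = sin (j π / q)`, of determinant
`s_1 ^ 2`. It represents the inverse of `g_{q,-k}`, see `coe_inv_elg`. -/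
noncomputable def invMat {q : ℕ} (hq : 3 ≤ q) (k : ℤ) : GL (Fin 2) ℝ :=
  GeneralLinearGroup.mkOfDetNeZero
    !![sinMul q k, sinMul q (k - 1); sinMul q (k + 1), sinMul q k] (by
      rw [det_fin_two_of, sinMul_sq_sub]
      exact pow_ne_zero _ (sinMul_pos one_pos (by omega)).ne')

/-- The matrix `[s_{k-1}, s_k; s_k, s_{k+1}]` with `s_j = sin (j π / q)`, which represents the
inverse of `Q g_{q,-k}`, see `coe_inv_elQ_mul_elg`. -/
noncomputable def invMatQ {q : ℕ} (hq : 3 ≤ q) (k : ℤ) : GL (Fin 2) ℝ :=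
  GeneralLinearGroup.mkOfDetNeZero
    !![sinMul q (k - 1), sinMul q k; sinMul q k, sinMul q (k + 1)] (by
      rw [det_fin_two_of, ← neg_sub, sinMul_sq_sub]
      exact neg_ne_zero.2 (pow_ne_zero _ (sinMul_pos one_pos (by omega)).ne'))

@[simp] lemma invMat_apply_zero_zero {q : ℕ} (hq : 3 ≤ q) (k : ℤ) :
    invMat hq k 0 0 = sinMul q k := rfl

@[simp] lemma invMat_apply_zero_one {q : ℕ} (hq : 3 ≤ q) (k : ℤ) :
    invMat hq k 0 1 = sinMul q (k - 1) := rfl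

@[simp] lemma invMat_apply_one_zero {q : ℕ} (hq : 3 ≤ q) (k : ℤ) :
    invMat hq k 1 0 = sinMul q (k + 1) := rfl

@[simp] lemma invMat_apply_one_one {q : ℕ} (hq : 3 ≤ q) (k : ℤ) :
    invMat hq k 1 1 = sinMul q k := rfl

@[simp] lemma invMatQ_apply_zero_zero {q : ℕ} (hq : 3 ≤ q) (k : ℤ) :
    invMatQ hq k 0 0 = sinMul q (k - 1) := rfl

@[simp] lemma invMatQ_apply_zero_one {q : ℕ} (hq : 3 ≤ q) (k : ℤ) :
    invMatQ hq k 0 1 = sinMul q k := rfl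

@[simp] lemma invMatQ_apply_one_zero {q : ℕ} (hq : 3 ≤ q) (k : ℤ) :
    invMatQ hq k 1 0 = sinMul q k := rfl

@[simp] lemma invMatQ_apply_one_one {q : ℕ} (hq : 3 ≤ q) (k : ℤ) :
    invMatQ hq k 1 1 = sinMul q (k + 1) := rfl

/-- Multiplication by `T S` lowers the index, by the three-term recursion of the sines; the
representing matrices differ by the scalar `-1`. -/
lemma matT_mul_matS_mul_mk_invMat {q : ℕ} (hq : 3 ≤ q) (k : ℤ) :
    matT q * matS * ProjGenLinGroup.mk (invMat hq (k + 1)) =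
      ProjGenLinGroup.mk (invMat hq k) := by
  have h1 := sinMul_add_one_add_sub_one q (k + 1)
  have h2 := sinMul_add_one_add_sub_one q k
  rw [add_sub_cancel_right] at h1
  rw [matT, matS, ← map_mul, ← map_mul, ProjGenLinGroup.mk_eq_mk_iff]
  refine ⟨-1, ?_⟩
  ext i j
  fin_cases i <;> fin_cases j <;>
    simp [invMat, Matrix.mul_apply, Matrix.diagonal] <;> linarith

lemma mk_invMat {q : ℕ} (hq : 3 ≤ q) (k : ℤ) :
    (matT q * matS) ^ (-k) * matS = ProjGenLinGroup.mk (invMat hq k) := by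
  induction k with
  | zero =>
    have h : 0 < sinMul q 1 := sinMul_pos one_pos (by omega)
    have h' : sinMul q (-1) = -sinMul q 1 := by simp [sinMul]
    rw [neg_zero, zpow_zero, one_mul, matS, ProjGenLinGroup.mk_eq_mk_iff]
    refine ⟨Units.mk0 (-sinMul q 1) (neg_ne_zero.2 h.ne'), ?_⟩
    ext i j
    fin_cases i <;> fin_cases j <;>
      simp [invMat, Matrix.mul_apply, Matrix.diagonal, h']
  | succ n ih =>
    rw [← mul_right_inj (matT q * matS), matT_mul_matS_mul_mk_invMat, ← ih, ← mul_assoc,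
      ← _root_.zpow_one_add]
    congr 2
    ring
  | pred n ih =>
    have := matT_mul_matS_mul_mk_invMat hq (-n - 1)
    rw [sub_add_cancel, ← ih, ← mul_assoc, ← _root_.zpow_one_add] at this
    rw [← this]
    congr 2
    ring

lemma coe_inv_elg {q : ℕ} (hq : 3 ≤ q) (k : ℤ) :
    (((elg q (-k))⁻¹ : triangleGroup q) : PGL(2, ℝ)) = ProjGenLinGroup.mk (invMat hq k) := by
  rw [elg, inv_inv, ← mk_invMat hq k]
  rfl

lemma coe_inv_elQ_mul_elg {q : ℕ} (hq : 3 ≤ q) (k : ℤ) :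
    (((elQ q * elg q (-k))⁻¹ : triangleGroup q) : PGL(2, ℝ)) =
      ProjGenLinGroup.mk (invMatQ hq k) := by
  rw [_root_.mul_inv_rev, Subgroup.coe_mul, coe_inv_elg hq, Subgroup.coe_inv, mul_inv_eq_iff_eq_mul]
  change _ = _ * matQ
  rw [matQ, ← map_mul]
  congr 1
  ext i j
  fin_cases i <;> fin_cases j <;>
    simp [invMat, invMatQ, Matrix.mul_apply, Fin.sum_univ_two]

/-! ### Boundedness and poles under the action `α_s` -/

section Action

variable {V : Type*} [NormedAddCommGroup V] [InnerProductSpace ℂ V] {q : ℕ}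

lemma mobius_mk (A : GL (Fin 2) ℝ) (x : ℝ) :
    mobius (ProjGenLinGroup.mk A) x = (A 0 0 * x + A 0 1) / (A 1 0 * x + A 1 1) := rfl

lemma absDeriv_mk (A : GL (Fin 2) ℝ) (x : ℝ) :
    absDeriv (ProjGenLinGroup.mk A) x =
      |A 0 0 * A 1 1 - A 0 1 * A 1 0| / (A 1 0 * x + A 1 1) ^ 2 := rfl

lemma tendsto_mobius_mk {A : GL (Fin 2) ℝ} {x : ℝ} (hd : A 1 0 * x + A 1 1 ≠ 0) :
    Tendsto (mobius (ProjGenLinGroup.mk A)) (𝓝 x) (𝓝 (mobius (ProjGenLinGroup.mk A) x)) := by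
  have : ContinuousAt (fun x => (A 0 0 * x + A 0 1) / (A 1 0 * x + A 1 1)) x :=
    ContinuousAt.div (by fun_prop) (by fun_prop) hd
  exact this

lemma tendsto_absDeriv_mk_cpow {A : GL (Fin 2) ℝ} {x : ℝ} (hd : A 1 0 * x + A 1 1 ≠ 0) (s : ℂ) :
    Tendsto (fun y => ((absDeriv (ProjGenLinGroup.mk A) y : ℝ) : ℂ) ^ s) (𝓝 x)
      (𝓝 (((absDeriv (ProjGenLinGroup.mk A) x : ℝ) : ℂ) ^ s)) := by
  have hdet : A 0 0 * A 1 1 - A 0 1 * A 1 0 ≠ 0 := by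
    rw [← det_fin_two]
    exact A.det_ne_zero
  have hpos : 0 < absDeriv (ProjGenLinGroup.mk A) x := by
    rw [absDeriv_mk]
    positivity
  have hc : ContinuousAt (absDeriv (ProjGenLinGroup.mk A)) x := by
    have : ContinuousAt (fun x => |A 0 0 * A 1 1 - A 0 1 * A 1 0| / (A 1 0 * x + A 1 1) ^ 2) x :=
      ContinuousAt.div (by fun_prop) (by fun_prop) (pow_ne_zero _ hd)
    exact this
  exact ((Complex.continuous_ofReal.tendsto _).comp hc.tendsto).cpow tendsto_const_nhds
    (Complex.ofReal_mem_slitPlane.2 hpos)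

/-- Away from the pole of `h⁻¹` the automorphy factor is bounded and `χ h` is an isometry, so
`α_s(h) f` is bounded wherever `f` is bounded along the image under `h⁻¹`. -/
lemma isBigO_alpha (χ : triangleGroup q →* (V ≃ₗᵢ[ℂ] V)) (s : ℂ) {h : triangleGroup q}
    {A : GL (Fin 2) ℝ}
    (hA : ((h⁻¹ : triangleGroup q) : PGL(2, ℝ)) = ProjGenLinGroup.mk A)
    {l m : Filter ℝ} {x : ℝ} (hl : l ≤ 𝓝 x) (hd : A 1 0 * x + A 1 1 ≠ 0)
    (hm : Tendsto (mobius (ProjGenLinGroup.mk A)) l m)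
    {f : ℝ → V} (hf : f =O[m] fun _ => (1 : ℝ)) :
    alpha χ s h f =O[l] fun _ => (1 : ℝ) := by
  have h1 : (fun y => ((absDeriv (ProjGenLinGroup.mk A) y : ℝ) : ℂ) ^ s) =O[l]
      fun _ => (1 : ℝ) := ((tendsto_absDeriv_mk_cpow hd s).mono_left hl).isBigO_one ℝ
  have h2 : (fun y => χ h (f (mobius (ProjGenLinGroup.mk A) y))) =O[l] fun _ => (1 : ℝ) :=
    IsBigO.of_norm_left <| by
      simpa only [LinearIsometryEquiv.norm_map] using! (hf.comp_tendsto hm).norm_left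
  have h3 := h1.smul h2
  simp only [smul_eq_mul, mul_one, ← hA] at h3
  exact h3

/-- `α_s(h) f` is bounded near `x` if `h⁻¹.x` is a finite point at which `f` is continuous. -/
lemma isBigO_alpha_of_continuousAt (χ : triangleGroup q →* (V ≃ₗᵢ[ℂ] V)) (s : ℂ)
    {h : triangleGroup q} {A : GL (Fin 2) ℝ}
    (hA : ((h⁻¹ : triangleGroup q) : PGL(2, ℝ)) = ProjGenLinGroup.mk A)
    {l : Filter ℝ} {x : ℝ} (hl : l ≤ 𝓝 x) (hd : A 1 0 * x + A 1 1 ≠ 0)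
    {f : ℝ → V} (hf : ContinuousAt f ((A 0 0 * x + A 0 1) / (A 1 0 * x + A 1 1))) :
    alpha χ s h f =O[l] fun _ => (1 : ℝ) :=
  isBigO_alpha χ s hA hl hd ((tendsto_mobius_mk hd).mono_left hl) (hf.isBigO_one ℝ)

omit [InnerProductSpace ℂ V] in
lemma isBigO_units_smul (ε : ℤˣ) {l : Filter ℝ} {f : ℝ → V} (hf : f =O[l] fun _ => (1 : ℝ)) :
    (fun x => ε • f x) =O[l] fun _ => (1 : ℝ) := by
  rcases Int.units_eq_one_or ε with rfl | rfl
  · simpa using hf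
  · simpa using hf.neg_left

lemma tendsto_ofReal_nhdsGT_zero : Tendsto (fun x : ℝ => (x : ℂ)) (𝓝[>] 0) (𝓝 0) := by
  simpa using (Complex.continuous_ofReal.tendsto 0).mono_left
    (nhdsWithin_le_nhds (s := Set.Ioi 0))

/-- The coefficient of the pole is the limit of `x f(x)`; in particular it is unique. -/
lemma HasPoleAsymptotics.tendsto_smul {f : ℝ → V} {c : V} (h : HasPoleAsymptotics f c) :
    Tendsto (fun x : ℝ => (x : ℂ) • f x) (𝓝[>] 0) (𝓝 c) := by
  have h0 := tendsto_const_nhds (x := c).add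
    (tendsto_ofReal_nhdsGT_zero.zero_smul_isBoundedUnder_le ((isBigO_one_iff ℝ).1 h))
  rw [add_zero] at h0
  refine h0.congr' ?_
  filter_upwards [self_mem_nhdsWithin] with x hx
  have : (x : ℂ) ≠ 0 := by exact_mod_cast (ne_of_gt hx)
  rw [smul_sub, smul_smul]
  simp [this]

/-- The branch `g_{-1}` is parabolic with fixed point `0`, hence it moves a simple pole at `0`
to a simple pole at `0` and acts on its coefficient by `χ(g_{-1})`. -/
lemma tendsto_smul_alpha_elg_neg_one (hq : 3 ≤ q) (χ : triangleGroup q →* (V ≃ₗᵢ[ℂ] V)) (s : ℂ)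
    {f : ℝ → V} {c : V} (h : HasPoleAsymptotics f c) :
    Tendsto (fun x : ℝ => (x : ℂ) • alpha χ s (elg q (-1)) f x) (𝓝[>] 0)
      (𝓝 (χ (elg q (-1)) c)) := by
  have hA := coe_inv_elg hq 1
  set A := invMat hq 1 with hAdef
  have h1 : 0 < sinMul q 1 := sinMul_pos one_pos (by omega)
  have h2 : 0 < sinMul q 2 := sinMul_pos two_pos (by omega)
  have e00 : A 0 0 = sinMul q 1 := by simp [hAdef, invMat]
  have e01 : A 0 1 = 0 := by simp [hAdef, invMat]
  have e10 : A 1 0 = sinMul q 2 := by simp [hAdef, invMat]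
  have e11 : A 1 1 = sinMul q 1 := by simp [hAdef, invMat]
  have hd : A 1 0 * 0 + A 1 1 ≠ 0 := by rw [e11]; simpa using h1.ne'
  -- `g_{-1}⁻¹.x = x / (1 + ℓ x)` is positive for `x > 0` and tends to `0`.
  have hmob : Tendsto (mobius (ProjGenLinGroup.mk A)) (𝓝[>] 0) (𝓝[>] 0) := by
    refine tendsto_nhdsWithin_iff.2 ⟨?_, ?_⟩
    · have := (tendsto_mobius_mk hd).mono_left (nhdsWithin_le_nhds (s := Set.Ioi 0))
      simpa [mobius_mk, e01] using this
    · filter_upwards [self_mem_nhdsWithin] with x hx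
      have hx : 0 < x := hx
      simp only [mobius_mk, e00, e01, e10, e11, Set.mem_Ioi]
      positivity
  have hfac := (tendsto_absDeriv_mk_cpow hd s).mono_left (nhdsWithin_le_nhds (s := Set.Ioi 0))
  have hone : absDeriv (ProjGenLinGroup.mk A) 0 = 1 := by
    rw [absDeriv_mk, e00, e01, e10, e11]
    simp [← sq, abs_of_pos h1, h1.ne']
  rw [hone, Complex.ofReal_one, Complex.one_cpow] at hfac
  have hratio : Tendsto (fun x : ℝ => (((sinMul q 2 * x + sinMul q 1) / sinMul q 1 : ℝ) : ℂ))
      (𝓝[>] 0) (𝓝 1) := by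
    have : ContinuousAt
        (fun x : ℝ => (((sinMul q 2 * x + sinMul q 1) / sinMul q 1 : ℝ) : ℂ)) 0 := by
      fun_prop
    have := this.tendsto.mono_left (nhdsWithin_le_nhds (s := Set.Ioi 0))
    simpa [h1.ne'] using this
  have hpole := ((χ (elg q (-1))).continuous.tendsto c).comp (h.tendsto_smul.comp hmob)
  -- With `y = g_{-1}⁻¹.x` write `x = (x / y) * y`, where the quotient `x / y` tends to `1`.
  have key := (hratio.mul hfac).smul hpole
  rw [one_mul, one_smul] at key
  refine key.congr' ?_
  filter_upwards [self_mem_nhdsWithin] with x hx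
  have hx : 0 < x := hx
  have hx' : (x : ℂ) ≠ 0 := by exact_mod_cast hx.ne'
  have hs1 : (sinMul q 1 : ℂ) ≠ 0 := by exact_mod_cast h1.ne'
  have hden : (sinMul q 2 * x + sinMul q 1 : ℂ) ≠ 0 := by
    exact_mod_cast (by positivity : sinMul q 2 * x + sinMul q 1 ≠ 0)
  have hm : mobius (ProjGenLinGroup.mk A) x = sinMul q 1 * x / (sinMul q 2 * x + sinMul q 1) := by
    rw [mobius_mk, e00, e01, e10, e11, add_zero]
  simp only [Function.comp_apply, alpha, hA, map_smul, smul_smul]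
  congr 1
  rw [hm]
  push_cast
  field_simp

end Action

/-! ### Eigenfunctions near the end points of the domain -/

lemma mem_slowDomain {q : ℕ} {x : ℝ} (h0 : 0 < x) (h1 : Odd q → x < 1) : x ∈ slowDomain q := by
  unfold slowDomain
  split_ifs with h
  · exact ⟨h0, h1 h⟩
  · exact h0

section Eigenfunctions

variable {V : Type*} [NormedAddCommGroup V] [InnerProductSpace ℂ V] {q : ℕ}
  {χ : triangleGroup q →* (V ≃ₗᵢ[ℂ] V)} {s : ℂ} {ε : ℤˣ} {φ : ℝ → V}

/-- For odd `q` every branch of the slow transfer operator maps the right end point `1` of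
`(0, 1)` into the interior of this interval. Hence the eigenfunctions are bounded near `1`. -/
lemma isBigO_nhdsLT_one_of_mem_SFE (hq : 3 ≤ q) (hodd : Odd q) (hφ : φ ∈ SFE χ s ε) :
    φ =O[𝓝[<] 1] fun _ => (1 : ℝ) := by
  have hslow : slowOp χ s ε φ =O[𝓝[<] 1] fun _ => (1 : ℝ) := by
    unfold slowOp
    simp only [if_neg (Nat.not_even_iff_odd.2 hodd), add_zero]
    refine IsBigO.fun_sum fun k hk => ?_
    rw [Finset.mem_Icc] at hk
    have hlt : sinMul q (k - 1) < sinMul q k :=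
      sinMul_lt_sinMul (by omega) (by omega) (by omega)
    have hle : sinMul q k ≤ sinMul q (k + 1) := sinMul_le_sinMul_add_one (by omega) (by omega)
    have h0 : 0 ≤ sinMul q (k - 1) := sinMul_nonneg (by omega) (by omega)
    have hmem : (sinMul q (k - 1) + sinMul q k) / (sinMul q k + sinMul q (k + 1))
        ∈ slowDomain q := by
      refine mem_slowDomain (div_pos (by linarith) (by linarith)) fun _ => ?_
      rw [div_lt_one (by linarith)]
      linarith
    refine IsBigO.add ?_ (isBigO_units_smul ε ?_)
    · refine isBigO_alpha_of_continuousAt χ s (coe_inv_elg hq k) nhdsWithin_le_nhds ?_ ?_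
      · simp only [invMat_apply_one_zero, invMat_apply_one_one]
        linarith
      · refine (hφ.1 _ ?_).continuousAt
        convert hmem using 1
        simp [add_comm]
    · refine isBigO_alpha_of_continuousAt χ s (coe_inv_elQ_mul_elg hq k) nhdsWithin_le_nhds ?_ ?_
      · simp only [invMatQ_apply_one_zero, invMatQ_apply_one_one]
        linarith
      · refine (hφ.1 _ ?_).continuousAt
        convert hmem using 1
        simp
  refine hslow.congr' ?_ EventuallyEq.rfl
  filter_upwards [Ioo_mem_nhdsLT zero_lt_one] with x hx
  exact (hφ.2 x (mem_slowDomain hx.1 fun _ => hx.2)).symm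

/-- For `2 ≤ k` the inverse of `g_{-k}` maps `0` into the interior of the domain. -/
lemma isBigO_alpha_elg_neg (hq : 3 ≤ q) (hφ : φ ∈ SFE χ s ε) {k : ℕ} (hk : 2 ≤ k)
    (hkq : k ≤ (q - 1) / 2) :
    alpha χ s (elg q (-(k : ℤ))) φ =O[𝓝[>] 0] fun _ => (1 : ℝ) := by
  have h0 : 0 < sinMul q (k - 1) := sinMul_pos (by omega) (by omega)
  have hlt : sinMul q (k - 1) < sinMul q k := sinMul_lt_sinMul (by omega) (by omega) (by omega)
  refine isBigO_alpha_of_continuousAt χ s (coe_inv_elg hq k) nhdsWithin_le_nhds ?_ ?_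
  · simpa using (h0.trans hlt).ne'
  · refine (hφ.1 _ ?_).continuousAt
    simp only [mul_zero, zero_add, invMat_apply_zero_one, invMat_apply_one_one]
    exact mem_slowDomain (div_pos h0 (h0.trans hlt)) fun _ => (div_lt_one (h0.trans hlt)).2 hlt

/-- The inverse of `Q g_{-k}` maps `0` into the interior of the domain, except for odd `q` and
`k = (q - 1) / 2`, where `0` is mapped to the end point `1`. -/
lemma isBigO_alpha_elQ_mul_elg_neg (hq : 3 ≤ q) (hφ : φ ∈ SFE χ s ε) {k : ℕ} (hk : 1 ≤ k)
    (hkq : k ≤ (q - 1) / 2) :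
    alpha χ s (elQ q * elg q (-(k : ℤ))) φ =O[𝓝[>] 0] fun _ => (1 : ℝ) := by
  have h0 : 0 < sinMul q k := sinMul_pos (by omega) (by omega)
  have h1 : 0 < sinMul q (k + 1) := sinMul_pos (by omega) (by omega)
  have hd : invMatQ hq k 1 0 * 0 + invMatQ hq k 1 1 ≠ 0 := by simpa using h1.ne'
  -- In the case `2 k + 1 = q` the image of `0` is `1`, which is approached from the left.
  by_cases hend : 2 * k + 1 = q
  · have hodd : Odd q := ⟨k, hend.symm⟩
    have heq : sinMul q (k + 1) = sinMul q k := by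
      rw [← sinMul_sub (by omega) (k : ℤ), ← hend]
      congr 1
      push_cast
      ring
    have hlt : sinMul q (k - 1) < sinMul q k :=
      sinMul_lt_sinMul (by omega) (by omega) (by omega)
    refine isBigO_alpha χ s (coe_inv_elQ_mul_elg hq k) nhdsWithin_le_nhds hd
      (tendsto_nhdsWithin_iff.2 ⟨?_, ?_⟩) (isBigO_nhdsLT_one_of_mem_SFE hq hodd hφ)
    · have := (tendsto_mobius_mk hd).mono_left (nhdsWithin_le_nhds (s := Set.Ioi 0))
      simpa [mobius_mk, heq, h0.ne'] using this
    · filter_upwards [self_mem_nhdsWithin] with x hx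
      have hx : 0 < x := hx
      simp only [mobius_mk, invMatQ_apply_zero_zero, invMatQ_apply_zero_one,
        invMatQ_apply_one_zero, invMatQ_apply_one_one, heq, Set.mem_Iio]
      rw [div_lt_one (by positivity)]
      gcongr
  · refine isBigO_alpha_of_continuousAt χ s (coe_inv_elQ_mul_elg hq k) nhdsWithin_le_nhds hd
      (hφ.1 _ ?_).continuousAt
    simp only [mul_zero, zero_add, invMatQ_apply_zero_one, invMatQ_apply_one_one]
    exact mem_slowDomain (div_pos h0 h1) fun _ =>
      (div_lt_one h1).2 (sinMul_lt_sinMul (by omega) (by omega) (by omega))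

/-- For even `q` the inverses of `g_{q/2}` and `Q g_{q/2}` map `0` to positive real numbers, that
is, into the domain `(0, ∞)`. -/
lemma isBigO_alpha_elg_half (hq : 3 ≤ q) (heven : Even q) (hφ : φ ∈ SFE χ s ε) :
    (alpha χ s (elg q ((q / 2 : ℕ) : ℤ)) φ =O[𝓝[>] 0] fun _ => (1 : ℝ)) ∧
      (alpha χ s (elQ q * elg q ((q / 2 : ℕ) : ℤ)) φ =O[𝓝[>] 0] fun _ => (1 : ℝ)) := by
  obtain ⟨n, hn⟩ := heven
  have hhalf : q / 2 = n := by omega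
  have hneg : ∀ k : ℤ, sinMul q (-k) = -sinMul q k := fun k => by simp [sinMul]
  have h0 : sinMul q (-n) < 0 := by
    rw [hneg, neg_lt_zero]
    exact sinMul_pos (by omega) (by omega)
  have h1 : sinMul q (-n - 1) < 0 := by
    rw [← neg_add', hneg, neg_lt_zero]
    exact sinMul_pos (by omega) (by omega)
  have h2 : sinMul q (-n + 1) < 0 := by
    rw [show -(n : ℤ) + 1 = -(n - 1) by ring, hneg, neg_lt_zero]
    exact sinMul_pos (by omega) (by omega)
  have hodd : ¬ Odd q := Nat.not_odd_iff_even.2 ⟨n, hn⟩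
  -- `g_{q/2}` is `g_{-k}` for `k = -q/2`.
  have hA := coe_inv_elg hq (-n)
  have hB := coe_inv_elQ_mul_elg hq (-n)
  rw [neg_neg] at hA hB
  rw [hhalf]
  constructor
  · refine isBigO_alpha_of_continuousAt χ s hA nhdsWithin_le_nhds ?_
      (hφ.1 _ (mem_slowDomain ?_ fun h => absurd h hodd)).continuousAt
    · simpa using h0.ne
    · simpa using div_pos_of_neg_of_neg h1 h0
  · refine isBigO_alpha_of_continuousAt χ s hB nhdsWithin_le_nhds ?_
      (hφ.1 _ (mem_slowDomain ?_ fun h => absurd h hodd)).continuousAt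
    · simpa using h2.ne
    · simpa using div_pos_of_neg_of_neg h0 h2

/-- Apart from `α_s(g_{-1}) φ`, all terms of the slow transfer operator are bounded near `0`. -/
lemma isBigO_sub_alpha_elg_neg_one (hq : 3 ≤ q) (hφ : φ ∈ SFE χ s ε) :
    (fun x => φ x - alpha χ s (elg q (-1)) φ x) =O[𝓝[>] 0] fun _ => (1 : ℝ) := by
  have hrest : (fun x => slowOp χ s ε φ x - alpha χ s (elg q (-1)) φ x) =O[𝓝[>] 0]
      fun _ => (1 : ℝ) := by
    have hlow : 1 ∈ Finset.Icc 1 ((q - 1) / 2) := Finset.mem_Icc.2 ⟨le_rfl, by omega⟩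
    have hsum : (fun x => ∑ k ∈ (Finset.Icc 1 ((q - 1) / 2)).erase 1,
        alpha χ s (elg q (-(k : ℤ))) φ x) =O[𝓝[>] 0] fun _ => (1 : ℝ) := by
      refine IsBigO.fun_sum fun k hk => ?_
      rw [Finset.mem_erase, Finset.mem_Icc] at hk
      exact isBigO_alpha_elg_neg hq hφ (by omega) hk.2.2
    have hsumQ : (fun x => ∑ k ∈ Finset.Icc 1 ((q - 1) / 2),
        ε • alpha χ s (elQ q * elg q (-(k : ℤ))) φ x) =O[𝓝[>] 0] fun _ => (1 : ℝ) := by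
      refine IsBigO.fun_sum fun k hk => isBigO_units_smul ε ?_
      rw [Finset.mem_Icc] at hk
      exact isBigO_alpha_elQ_mul_elg_neg hq hφ hk.1 hk.2
    have hhalf : (fun x => if Even q then
        (1 / 2 : ℂ) • (alpha χ s (elg q ((q / 2 : ℕ) : ℤ)) φ x
          + ε • alpha χ s (elQ q * elg q ((q / 2 : ℕ) : ℤ)) φ x)
        else 0) =O[𝓝[>] 0] fun _ => (1 : ℝ) := by
      split_ifs with heven
      · obtain ⟨h1, h2⟩ := isBigO_alpha_elg_half hq heven hφ
        exact (h1.add (isBigO_units_smul ε h2)).const_smul_left (1 / 2 : ℂ)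
      · exact isBigO_zero _ _
    refine ((hsum.add hsumQ).add hhalf).congr_left fun x => ?_
    rw [slowOp, Finset.sum_add_distrib,
      ← Finset.add_sum_erase _ (fun k : ℕ => alpha χ s (elg q (-(k : ℤ))) φ x) hlow, Nat.cast_one]
    abel
  refine hrest.congr' ?_ EventuallyEq.rfl
  filter_upwards [Ioo_mem_nhdsGT zero_lt_one] with x hx
  rw [← hφ.2 x (mem_slowDomain hx.1 fun _ => hx.2)]

/-- The coefficient of the pole of an eigenfunction at `0` is fixed by `χ(g_{-1})`. -/
lemma HasPoleAsymptotics.mem_fixedSpace (hq : 3 ≤ q) (hφ : φ ∈ SFE χ s ε) {c : V}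
    (hc : HasPoleAsymptotics φ c) : c ∈ fixedSpace χ := by
  have h0 := tendsto_ofReal_nhdsGT_zero.zero_smul_isBoundedUnder_le
    ((isBigO_one_iff ℝ).1 (isBigO_sub_alpha_elg_neg_one hq hφ))
  have h1 := hc.tendsto_smul.sub (tendsto_smul_alpha_elg_neg_one hq χ s hc)
  simp only [← smul_sub] at h1
  exact (sub_eq_zero.1 (tendsto_nhds_unique h1 h0)).symm

end Eigenfunctions

end HeckeSFE

theorem mainTheorem4 {V : Type*} [NormedAddCommGroup V] [InnerProductSpace ℂ V]
    [FiniteDimensional ℂ V] (q : ℕ) (hq : 3 ≤ q)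
    (χ : HeckeSFE.triangleGroup q →* (V ≃ₗᵢ[ℂ] V)) (ε : ℤˣ)
    (s : ℂ) (hs : 0 < s.re) (hs' : s ≠ 1 / 2) :
    HeckeSFE.SFEas χ s ε =
      {φ | φ ∈ HeckeSFE.SFE χ s ε ∧
        ∃ c : V, HeckeSFE.prr χ c = 0 ∧ HeckeSFE.HasPoleAsymptotics φ c} := by
  ext φ
  refine ⟨fun ⟨hφ, c, hc⟩ => ⟨hφ, c, ?_, hc⟩, fun ⟨hφ, c, _, hc⟩ => ⟨hφ, c, hc⟩⟩
  exact Submodule.orthogonalProjectionOnto_orthogonal_apply_eq_zero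
    (hc.mem_fixedSpace hq hφ)
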